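/- Let $G=\langle a_1,\dots,a_n \mid {}_{m_{ij}}(a_i,a_j)={}_{m_{ij}}(a_j,a_i)\ (i\ne j,\ m_{ij}\neq\infty)\rangle$ be the Artin group of a Coxeter matrix $(m_{ij})$ with entries in $\mathbb N\cup\{\infty\}$, where ${}_t(x,y)=xyx\cdots$ ($t$ alternating factors). Suppose that $G$ is of almost large type: in every triangle of indices, some edge is labelled $\infty$ or no edge is labelled $2$; in every square of indices, some edge is labelled $\infty$ or at most one edge is labelled $2$. For $i\ne j$ with $m=m_{ij}<\infty$, let $G_{ij}=\langle a_i,a_j\rangle$ and $\Delta_{ij}={}_m(a_i,a_j)={}_m(a_j,a_i)$. The Garside generators of $G_{ij}$ are the elements ${}_t(a_i,a_j)$ and ${}_t(a_j,a_i)$ with $1\le t\le m$. *The complex.* Each $g\in G_{ij}$ is the initial vertex of a precell of type $\{i,j\}$: the $2m$-cycle in the Cayley graph of $G_{ij}$ whose two half boundaries are the paths from $g$ to $g\Delta_{ij}$ labelled ${}_m(a_i,a_j)$ and ${}_m(a_j,a_i)$. Triangulate it with interior vertices $o_1,\dots,o_{m-2}$: with $o_0=g$, $o_{m-1}=g\Delta_{ij}$,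 add the edges $o_t o_{t+1}$ ($0\le t\le m-2$) and the edges from $o_t$ ($1\le t\le m-2$) to the vertices at distances $t$ and $t+1$ from $g$ on each half boundary. If a path of $k\ge2$ edges is the proper suffix, starting at distance $t=m-k$ from the initial vertex, of a half boundary of one precell (with interior vertices $o_s$), and a proper prefix of a half boundary of another (with interior vertices $o'_s$), add the edges of the zigzag $o_t,o'_1,o_{t+1},o'_2,\dots,o_{m-2},o'_{k-1}$. The flag complex on the resulting graph is $X_{ij}$. The Huang–Osajda complex $X$ of $G$ is obtained from the Cayley graph of $G$ by gluing in a copy $gX_{ij}$ of $X_{ij}$ along every coset $gG_{ij}$, for all $\{i,j\}$ with $m_{ij}<\infty$; $G$ acts on $X$ on the left. Let $v_0$ be the vertex $1$, and let $\Pi_0^{ij}$ be the precell of type $\{i,j\}$ with initial vertex $v_0$. *The alphabets.* Let $V_0$ be a set of representatives, containing $v_0$, of the $G$-orbits of simplices of $X$. For a simplex $\sigma$ with representative $\bar\sigma\in V_0$ let $\Lambda_\sigma=\{g\in G:\sigma=g\bar\sigma\}$, and let $\Lambda_{\sigma,\tau}=\Lambda_\sigma^{-1}\Lambda_\tau$.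 Let $\mathcal A\subseteq G$ be the union of the stabilizer $G_{v_0}$ and all $\Lambda_{\sigma,\tau}$ with $\sigma,\tau$ disjoint simplices that together span a simplex, and let $\mathcal B\subseteq G$ be the union of $G_{v_0}$ and all $\Lambda_{\sigma,\tau}$ with $\sigma\subseteq\tau$ or $\tau\subseteq\sigma$. *The choice of $V_0$.* Suppose that, for all $\{i,j\}$ with $m_{ij}<\infty$, the simplices in $V_0$ that lie in $X_{ij}$ form a set of representatives of the $G_{ij}$-orbits of simplices of $X_{ij}$ that is based on $\Pi_0^{ij}$, that is: (1) it contains $v_0$ and the edges $\{v_0,a_iv_0\}$ and $\{v_0,a_jv_0\}$; (2) it contains all interior vertices and interior edges of $\Pi_0^{ij}$; (3) each of its simplices contains $v_0$ or an interior vertex of $\Pi_0^{ij}$. Call $k$ isolated if $m_{kj}=\infty$ for all $j\ne k$, and suppose that $V_0$ contains the edge $\{v_0,a_kv_0\}$ for every isolated $k$. Then $\mathcal A=\mathcal B=Y\cup Y^{-1}\cup\{1\}$, where $Y$ is the union of the sets of Garside generators of the subgroups $G_{ij}$ with $m_{ij}<\infty$, together with the generators $a_k$ for isolated $k$ (so $Y$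 is just the union of the Garside generating sets if there is no isolated $k$). -/

import Mathlib

open scoped Pointwise

/-- The alternating product `x * y * x * ⋯` with `t` factors, starting with `x`. -/
def altProd {G : Type*} [Monoid G] (x y : G) : ℕ → G
  | 0 => 1
  | t + 1 => x * altProd y x t

/-- The defining relators of the Artin group of a Coxeter matrix
(in `CoxeterMatrix`, an entry `0` stands for `∞`). -/
def artinRelators {n : ℕ} (M : CoxeterMatrix (Fin n)) : Set (FreeGroup (Fin n)) :=
  {r | ∃ i j, i ≠ j ∧ M i j ≠ 0 ∧
    r = altProd (FreeGroup.of i) (FreeGroup.of j) (M i j) *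
      (altProd (FreeGroup.of j) (FreeGroup.of i) (M j i))⁻¹}

/-- The Artin group `⟨a₁, …, aₙ ∣ a_i a_j a_i ⋯ = a_j a_i a_j ⋯ (m_ij factors), m_ij ≠ ∞⟩`. -/
abbrev ArtinGroup {n : ℕ} (M : CoxeterMatrix (Fin n)) : Type :=
  PresentedGroup (artinRelators M)

/-- Almost large type: in a triangle without edge labelled `∞` no edge is labelled `2`, and in a
square without edge labelled `∞` at most one edge is labelled `2`. -/
def IsAlmostLarge {n : ℕ} (M : CoxeterMatrix (Fin n)) : Prop :=
  (∀ i j k : Fin n, i ≠ j → j ≠ k → i ≠ k →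
    (M i j = 0 ∨ M j k = 0 ∨ M k i = 0) ∨ (M i j ≠ 2 ∧ M j k ≠ 2 ∧ M k i ≠ 2)) ∧
  (∀ i j k l : Fin n, [i, j, k, l].Nodup →
    (M i j = 0 ∨ M j k = 0 ∨ M k l = 0 ∨ M l i = 0) ∨
      [M i j, M j k, M k l, M l i].count 2 ≤ 1)

namespace ArtinComplex

variable {n : ℕ} {M : CoxeterMatrix (Fin n)}

/-- The standard generator `a_k`. -/
def gen (M : CoxeterMatrix (Fin n)) (k : Fin n) : ArtinGroup M := PresentedGroup.of k

/-- The generator `a_k` occurs in no relation: `m_kj = ∞` for all `j ≠ k`. -/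
def IsIsolated (M : CoxeterMatrix (Fin n)) (k : Fin n) : Prop := ∀ j, j ≠ k → M k j = 0

/-- An unordered pair `{i, j}`, written with `i < j`, such that `m_ij` is finite. -/
structure FinPair (M : CoxeterMatrix (Fin n)) where
  i : Fin n
  j : Fin n
  lt : i < j
  fin : M i j ≠ 0

/-- The label `m_ij`. -/
def FinPair.m (e : FinPair M) : ℕ := M e.i e.j

/-- The dihedral parabolic subgroup `G_ij = ⟨a_i, a_j⟩`. -/
def FinPair.parabolic (e : FinPair M) : Subgroup (ArtinGroup M) :=
  Subgroup.closure {gen M e.i, gen M e.j}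

/-- The `t`-th vertex, `0 ≤ t ≤ m_ij`, of one of the two half boundaries of the precell with
initial vertex `1`: the product of `t` alternating letters, starting with `a_i` or with `a_j`. -/
def FinPair.half (e : FinPair M) (b : Bool) (t : ℕ) : ArtinGroup M :=
  if b then altProd (gen M e.i) (gen M e.j) t else altProd (gen M e.j) (gen M e.i) t

/-- The Garside element `Δ_ij`, the terminal vertex of the precell with initial vertex `1`. -/
def FinPair.delta (e : FinPair M) : ArtinGroup M := e.half true e.m

/-- The Garside generators of `G_ij`: the alternating products of `a_i` and `a_j` with at least
one and at most `m_ij` factors (those with `m_ij` factors are both equal to `Δ_ij`). -/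
def FinPair.garside (e : FinPair M) : Set (ArtinGroup M) :=
  {g | ∃ (b : Bool) (t : ℕ), 1 ≤ t ∧ t ≤ e.m ∧ g = e.half b t}

/-- Vertices of the complex: the real ones are the elements of `G`, and each precell, given by its
type `{i, j}` and its initial vertex `g`, has `m_ij - 2` interior vertices. -/
inductive Vertex (M : CoxeterMatrix (Fin n)) : Type
  | real (g : ArtinGroup M) : Vertex M
  | interior (g : ArtinGroup M) (e : FinPair M) (t : {t : ℕ // 1 ≤ t ∧ t + 2 ≤ e.m}) : Vertex M

noncomputable instance : DecidableEq (Vertex M) := Classical.decEq _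

/-- The action of `G` on the vertices. -/
instance : MulAction (ArtinGroup M) (Vertex M) where
  smul g v := match v with
    | .real h => .real (g * h)
    | .interior h e t => .interior (g * h) e t
  one_smul v := by
    cases v with
    | real h => exact congrArg Vertex.real (one_mul h)
    | interior h e t => exact congrArg (fun x => Vertex.interior x e t) (one_mul h)
  mul_smul g g' v := by
    cases v with
    | real h => exact congrArg Vertex.real (mul_assoc g g' h)
    | interior h e t => exact congrArg (fun x => Vertex.interior x e t) (mul_assoc g g' h)

/-- The vertices `o_0, o_1, …, o_{m-1}` on the axis of the precell of type `{i, j}` with initial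
vertex `g`: the initial vertex `o_0`, the interior vertices `o_1, …, o_{m-2}` and the terminal
vertex `o_{m-1}`. -/
def FinPair.axis (e : FinPair M) (g : ArtinGroup M) (t : ℕ) : Vertex M :=
  if h : 1 ≤ t ∧ t + 2 ≤ e.m then .interior g e ⟨t, h⟩
  else if t = 0 then .real g else .real (g * e.delta)

/-- The interior edges of the precell of type `{i, j}` with initial vertex `g`: the `m_ij - 1` edges
of the axis, and the four edges that join `o_t`, `1 ≤ t ≤ m_ij - 2`, to the `t`-th and to the
`(t+1)`-st vertex of each half boundary. -/
inductive PrecellEdge (e : FinPair M) (g : ArtinGroup M) : Vertex M → Vertex M → Prop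
  | along (t : ℕ) : t + 2 ≤ e.m → PrecellEdge e g (e.axis g t) (e.axis g (t + 1))
  | back (b : Bool) (t : ℕ) : 1 ≤ t → t + 2 ≤ e.m →
      PrecellEdge e g (e.axis g t) (.real (g * e.half b t))
  | forth (b : Bool) (t : ℕ) : 1 ≤ t → t + 2 ≤ e.m →
      PrecellEdge e g (e.axis g t) (.real (g * e.half b (t + 1)))

/-- The precells of type `{i, j}` with initial vertices `g` and `h` overlap in a path of `k ≥ 2`
edges, which is a proper suffix of a half boundary of the first (it starts at distance `t ≥ 1` from
`g`) and a proper prefix of a half boundary of the second (it starts at `h`). -/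
def FinPair.Overlap (e : FinPair M) (g h : ArtinGroup M) (t k : ℕ) : Prop :=
  1 ≤ t ∧ 2 ≤ k ∧ t + k = e.m ∧
    ∃ b b' : Bool, ∀ s ≤ k, g * e.half b (t + s) = h * e.half b' s

/-- The edges added between two overlapping precells. The `k - 1` interior vertices
`A_s = o_{t+s}` of the first and `B_s = o_{s+1}` of the second, `0 ≤ s ≤ k - 2`, next to the path
are joined in a zigzag `A_0, B_0, A_1, B_1, …, A_{k-2}, B_{k-2}`. -/
inductive ZigzagEdge (e : FinPair M) (g h : ArtinGroup M) : Vertex M → Vertex M → Prop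
  | zig (t k s : ℕ) : e.Overlap g h t k → s + 2 ≤ k →
      ZigzagEdge e g h (e.axis g (t + s)) (e.axis h (s + 1))
  | zag (t k s : ℕ) : e.Overlap g h t k → s + 3 ≤ k →
      ZigzagEdge e g h (e.axis h (s + 1)) (e.axis g (t + s + 1))

/-- The edges, each taken in one direction, of the 1-skeleta of the copies of `X_ij` in the
complex. -/
inductive PairEdge (e : FinPair M) : Vertex M → Vertex M → Prop
  | cayley (g : ArtinGroup M) (k : Fin n) : k = e.i ∨ k = e.j →
      PairEdge e (.real g) (.real (g * gen M k))
  | precell (g : ArtinGroup M) (v w : Vertex M) : PrecellEdge e g v w → PairEdge e v w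
  | zigzag (g h : ArtinGroup M) (v w : Vertex M) : ZigzagEdge e g h v w → PairEdge e v w

/-- The (disjoint) union of the 1-skeleta of the copies of `X_ij` in the complex. -/
def FinPair.graph (e : FinPair M) : SimpleGraph (Vertex M) := SimpleGraph.fromRel (PairEdge e)

/-- The vertices of `X_ij`: the elements of `G_ij` and the interior vertices of the precells of
type `{i, j}` whose initial vertex is in `G_ij`. -/
def FinPair.verts (e : FinPair M) : Set (Vertex M) :=
  {v | ∃ g ∈ e.parabolic, v = .real g ∨ ∃ t, v = .interior g e t}

/-- The flag complex `X_ij` built from the Cayley graph of `G_ij`. -/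
def FinPair.complex (e : FinPair M) : PreAbstractSimplicialComplex (Vertex M) where
  faces := {s | s.Nonempty ∧ (s : Set (Vertex M)) ⊆ e.verts ∧ e.graph.IsClique s}
  isRelLowerSet_faces _ hs := ⟨hs.1, fun _ hts ht =>
    ⟨ht, (Finset.coe_subset.2 hts).trans hs.2.1, hs.2.2.subset (Finset.coe_subset.2 hts)⟩⟩

/-- The base vertex `v_0`. -/
def base (M : CoxeterMatrix (Fin n)) : Vertex M := .real 1

/-- The edge of the Cayley graph that joins `g` to `g a_k`. -/
noncomputable def cayleyEdge (g : ArtinGroup M) (k : Fin n) : Finset (Vertex M) :=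
  {.real g, .real (g * gen M k)}

/-- The simplices of the Huang–Osajda complex: the vertices and edges of the Cayley graph of `G`,
and the simplices of the translates `g X_ij`, `g ∈ G`, `m_ij ≠ ∞`. -/
inductive IsSimplex (M : CoxeterMatrix (Fin n)) : Finset (Vertex M) → Prop
  | vertex (g : ArtinGroup M) : IsSimplex M {.real g}
  | edge (g : ArtinGroup M) (k : Fin n) : IsSimplex M (cayleyEdge g k)
  | pair (g : ArtinGroup M) (e : FinPair M) (s : Finset (Vertex M)) :
      s ∈ e.complex.faces → IsSimplex M (g • s)

theorem IsSimplex.nonempty {s : Finset (Vertex M)} (hs : IsSimplex M s) : s.Nonempty := by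
  cases hs with
  | vertex g => exact Finset.singleton_nonempty _
  | edge g k => exact Finset.insert_nonempty _ _
  | pair g e s hs => exact Finset.Nonempty.smul_finset hs.1

theorem IsSimplex.subset {s t : Finset (Vertex M)} (hs : IsSimplex M s) (hts : t ⊆ s)
    (ht : t.Nonempty) : IsSimplex M t := by
  cases hs with
  | vertex g =>
    rw [ht.subset_singleton_iff.1 hts]
    exact .vertex g
  | edge g k =>
    rcases Set.subset_pair_iff_eq.1 (by simpa [cayleyEdge] using Finset.coe_subset.2 hts) with
      h | h | h | h
    · exact absurd (Finset.coe_eq_empty.1 h) ht.ne_empty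
    · rw [Finset.coe_eq_singleton.1 h]
      exact .vertex _
    · rw [Finset.coe_eq_singleton.1 h]
      exact .vertex _
    · have h' : t = cayleyEdge g k := Finset.coe_injective (by simpa [cayleyEdge] using h)
      rw [h']
      exact .edge g k
  | pair g e s hs =>
    have h := IsSimplex.pair g e (g⁻¹ • t)
      (e.complex.isRelLowerSet_faces hs |>.2 (Finset.smul_finset_subset_iff.2 (by simpa using hts))
        ht.smul_finset)
    rwa [smul_inv_smul] at h

theorem IsSimplex.singleton (v : Vertex M) : IsSimplex M {v} := by
  cases v with
  | real g => exact .vertex g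
  | interior g e t =>
    have h := IsSimplex.pair g e {Vertex.interior 1 e t}
      ⟨Finset.singleton_nonempty _, by simpa using ⟨1, one_mem _, .inr ⟨t, rfl⟩⟩, by simp⟩
    rw [Finset.smul_finset_singleton] at h
    exact (congrArg (fun x => ({Vertex.interior x e t} : Finset (Vertex M))) (mul_one g)) ▸ h

/-- The Huang–Osajda complex `X` of the Artin group. -/
def complex (M : CoxeterMatrix (Fin n)) : AbstractSimplicialComplex (Vertex M) where
  faces := {s | IsSimplex M s}
  isRelLowerSet_faces _ hs := ⟨hs.nonempty, fun _ hts ht => hs.subset hts ht⟩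
  singleton_mem := IsSimplex.singleton

/-- `V` is a set of representatives of the orbits of the subgroup `H` on the set `S` of
simplices. -/
def IsOrbitReps (H : Subgroup (ArtinGroup M)) (S V : Set (Finset (Vertex M))) : Prop :=
  V ⊆ S ∧ ∀ σ ∈ S, ∃! τ, τ ∈ V ∧ ∃ h ∈ H, σ = h • τ

/-- A set `V` of simplices of `X_ij` is based on the precell `Π_0` of type `{i, j}` with initial
vertex `v_0`. -/
structure IsBased (e : FinPair M) (V : Set (Finset (Vertex M))) : Prop where
  base_mem : {base M} ∈ V
  edge_i_mem : cayleyEdge 1 e.i ∈ V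
  edge_j_mem : cayleyEdge 1 e.j ∈ V
  interior_vertex_mem : ∀ t, {Vertex.interior 1 e t} ∈ V
  interior_edge_mem : ∀ v w, PrecellEdge e 1 v w → {v, w} ∈ V
  meets : ∀ σ ∈ V, base M ∈ σ ∨ ∃ t, Vertex.interior 1 e t ∈ σ

/-- `V` is a set of representatives, containing `v_0`, of the `G`-orbits of simplices of `X`, and
for each finite `m_ij` the simplices in `V` that lie in `X_ij` represent the `G_ij`-orbits of
simplices of `X_ij` and are based on the precell with initial vertex `v_0`. An edge of the Cayley
graph that lies in no translate of any `X_ij` is represented by an edge that starts at `v_0`. -/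
structure IsBasedReps (V : Set (Finset (Vertex M))) : Prop where
  reps : IsOrbitReps ⊤ (complex M).faces V
  base_mem : {base M} ∈ V
  pair_reps : ∀ e : FinPair M, IsOrbitReps e.parabolic e.complex.faces (V ∩ e.complex.faces)
  pair_based : ∀ e : FinPair M, IsBased e (V ∩ e.complex.faces)
  isolated_mem : ∀ k, IsIsolated M k → cayleyEdge 1 k ∈ V

/-- The set `Λ_σ` of labels of a simplex, for the orbit representatives `V`. -/
def labels (V : Set (Finset (Vertex M))) (σ : Finset (Vertex M)) : Set (ArtinGroup M) :=
  {g | ∃ τ ∈ V, σ = g • τ}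

/-- The set `Λ_{σ,τ} = Λ_σ⁻¹ Λ_τ` of labels of a pair of simplices. -/
def pairLabels (V : Set (Finset (Vertex M))) (σ τ : Finset (Vertex M)) : Set (ArtinGroup M) :=
  (labels V σ)⁻¹ * labels V τ

/-- The alphabet `𝒜`: the stabilizer of `v_0` and the labels of the pairs of disjoint simplices that
together span a simplex. -/
def alphabetA (V : Set (Finset (Vertex M))) : Set (ArtinGroup M) :=
  (MulAction.stabilizer (ArtinGroup M) (base M) : Set (ArtinGroup M)) ∪
    {g | ∃ σ ∈ (complex M).faces, ∃ τ ∈ (complex M).faces,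
      Disjoint σ τ ∧ σ ∪ τ ∈ (complex M).faces ∧ g ∈ pairLabels V σ τ}

/-- The alphabet `ℬ`: the stabilizer of `v_0` and the labels of the pairs of simplices that are
related by inclusion or reverse inclusion. -/
def alphabetB (V : Set (Finset (Vertex M))) : Set (ArtinGroup M) :=
  (MulAction.stabilizer (ArtinGroup M) (base M) : Set (ArtinGroup M)) ∪
    {g | ∃ σ ∈ (complex M).faces, ∃ τ ∈ (complex M).faces,
      (σ ⊆ τ ∨ τ ⊆ σ) ∧ g ∈ pairLabels V σ τ}

/-- The union of the Garside generating sets of the subgroups `G_ij` with `m_ij` finite, and of the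
generators `a_k` of the subgroups `⟨a_k⟩` for the isolated `k`. -/
def garsideUnion (M : CoxeterMatrix (Fin n)) : Set (ArtinGroup M) :=
  (⋃ e : FinPair M, e.garside) ∪ {g | ∃ k, IsIsolated M k ∧ g = gen M k}

end ArtinComplex

/-! Everything is read off an equivariant map from vertices to `G`, the origin: a real vertex goes
to itself, an interior vertex to the initial vertex of its precell. Two facts give the upper bound.
Along every edge the origins differ by an element of `Y ∪ Y⁻¹ ∪ {1}`, hence so do those of any two
vertices of a simplex (`IsSimplex.origin_of_mem`). And every label of a simplex is the origin of one
of its vertices, because each representative has a vertex with origin `1`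
(`IsBasedReps.exists_origin`). Since a pair of simplices defining a letter lies in a common simplex,
its labels differ by such an element.

Conversely, each element of `Y` is the origin of one end of an edge in `V` whose other end has
origin `1` (`IsBasedReps.exists_edge_mem`). The two ends give it as a letter of `𝒜`; the edge and
one end give it as a letter of `ℬ`. -/

namespace ArtinComplex

variable {n : ℕ} {M : CoxeterMatrix (Fin n)}

/-! ### Origins and the action of `G` -/

/-- The group element at which a vertex is based: a real vertex is based at itself, an interior
vertex at the initial vertex of its precell. -/
def Vertex.origin : Vertex M → ArtinGroup M
  | .real g => g
  | .interior g _ _ => g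

theorem Vertex.origin_smul (g : ArtinGroup M) (v : Vertex M) :
    (g • v).origin = g * v.origin := by
  cases v <;> rfl

theorem smul_real (g h : ArtinGroup M) : g • (Vertex.real h : Vertex M) = .real (g * h) := rfl

theorem smul_interior (g h : ArtinGroup M) (e : FinPair M) (t) :
    g • (Vertex.interior h e t : Vertex M) = .interior (g * h) e t := rfl

theorem smul_cayleyEdge (g h : ArtinGroup M) (k : Fin n) :
    g • cayleyEdge h k = cayleyEdge (g * h) k := by
  simp [cayleyEdge, Finset.smul_finset_insert, smul_real, mul_assoc]

/-! ### The Garside alphabet -/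

/-- The alphabet of the main theorem. -/
def garsideAlphabet (M : CoxeterMatrix (Fin n)) : Set (ArtinGroup M) :=
  garsideUnion M ∪ (garsideUnion M)⁻¹ ∪ {1}

theorem one_mem_garsideAlphabet : (1 : ArtinGroup M) ∈ garsideAlphabet M := Or.inr rfl

theorem mem_garsideAlphabet_of_mem {g : ArtinGroup M} (h : g ∈ garsideUnion M) :
    g ∈ garsideAlphabet M := Or.inl (Or.inl h)

theorem inv_mem_garsideAlphabet {g : ArtinGroup M} (h : g ∈ garsideAlphabet M) :
    g⁻¹ ∈ garsideAlphabet M := by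
  rcases h with (h | h) | h
  · exact Or.inl (Or.inr (by simpa using h))
  · exact Or.inl (Or.inl h)
  · exact Or.inr (by simpa using h)

theorem inv_mul_mem_garsideAlphabet_comm {g h : ArtinGroup M}
    (H : g⁻¹ * h ∈ garsideAlphabet M) : h⁻¹ * g ∈ garsideAlphabet M := by
  simpa using inv_mem_garsideAlphabet H

theorem FinPair.two_le_m (e : FinPair M) : 2 ≤ e.m := by
  have h0 : e.m ≠ 0 := e.fin
  have h1 : e.m ≠ 1 := M.off_diagonal e.i e.j e.lt.ne
  omega

theorem FinPair.half_mem_garsideAlphabet (e : FinPair M) (b : Bool) {t : ℕ} (h1 : 1 ≤ t)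
    (ht : t ≤ e.m) : e.half b t ∈ garsideAlphabet M :=
  mem_garsideAlphabet_of_mem (Or.inl (Set.mem_iUnion.2 ⟨e, b, t, h1, ht, rfl⟩))

theorem FinPair.delta_mem_garsideAlphabet (e : FinPair M) : e.delta ∈ garsideAlphabet M :=
  e.half_mem_garsideAlphabet true (by have := e.two_le_m; omega) le_rfl

theorem FinPair.half_true_one (e : FinPair M) : e.half true 1 = gen M e.i := by
  simp [FinPair.half, altProd]

theorem FinPair.half_false_one (e : FinPair M) : e.half false 1 = gen M e.j := by
  simp [FinPair.half, altProd]

/-- The two half boundaries of a precell end at the same vertex. -/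
theorem FinPair.half_m (e : FinPair M) (b : Bool) : e.half b e.m = e.delta := by
  cases b with
  | true => rfl
  | false =>
    have hmap : ∀ (x y : Fin n) (t : ℕ), PresentedGroup.mk (artinRelators M)
        (altProd (FreeGroup.of x) (FreeGroup.of y) t) = altProd (gen M x) (gen M y) t := by
      intro x y t
      induction t generalizing x y with
      | zero => exact map_one _
      | succ t ih => simp only [altProd, map_mul, ih]; rfl
    -- This is the defining relation of the pair; its second word has length `M j i`, whence the
    -- later use of symmetry.
    have h : PresentedGroup.mk (artinRelators M) _ = 1 :=
      PresentedGroup.one_of_mem ⟨e.i, e.j, e.lt.ne, e.fin, rfl⟩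
    rw [map_mul, map_inv, hmap, hmap, mul_inv_eq_one, M.symmetric e.j e.i] at h
    exact h.symm

/-- A generator that is not isolated belongs to a pair with finite label. -/
theorem exists_finPair_of_not_isIsolated {k : Fin n} (hk : ¬ IsIsolated M k) :
    ∃ e : FinPair M, k = e.i ∨ k = e.j := by
  simp only [IsIsolated, not_forall] at hk
  obtain ⟨j, hj, hM⟩ := hk
  rcases lt_or_gt_of_ne hj with h | h
  · exact ⟨⟨j, k, h, by rwa [M.symmetric]⟩, Or.inr rfl⟩
  · exact ⟨⟨k, j, h, hM⟩, Or.inl rfl⟩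

theorem gen_mem_garsideAlphabet (k : Fin n) : gen M k ∈ garsideAlphabet M := by
  by_cases hk : IsIsolated M k
  · exact mem_garsideAlphabet_of_mem (Or.inr ⟨k, hk, rfl⟩)
  · obtain ⟨e, rfl | rfl⟩ := exists_finPair_of_not_isIsolated hk
    · rw [← e.half_true_one]
      exact e.half_mem_garsideAlphabet _ le_rfl (by have := e.two_le_m; omega)
    · rw [← e.half_false_one]
      exact e.half_mem_garsideAlphabet _ le_rfl (by have := e.two_le_m; omega)

/-! ### Origins along edges and in simplices -/

theorem FinPair.axis_of_interior (e : FinPair M) (g : ArtinGroup M) {t : ℕ}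
    (h : 1 ≤ t ∧ t + 2 ≤ e.m) : e.axis g t = .interior g e ⟨t, h⟩ := dif_pos h

theorem FinPair.axis_zero (e : FinPair M) (g : ArtinGroup M) : e.axis g 0 = .real g := by
  simp [FinPair.axis]

theorem FinPair.axis_terminal (e : FinPair M) (g : ArtinGroup M) :
    e.axis g (e.m - 1) = .real (g * e.delta) := by
  have h := e.two_le_m
  rw [FinPair.axis, dif_neg (by omega), if_neg (by omega)]

theorem FinPair.origin_axis (e : FinPair M) (g : ArtinGroup M) {t : ℕ} (h : t + 2 ≤ e.m) :
    (e.axis g t).origin = g := by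
  rcases Nat.eq_zero_or_pos t with rfl | h0
  · rw [e.axis_zero]; rfl
  · rw [e.axis_of_interior g ⟨h0, h⟩]; rfl

/-- Every axis vertex except the terminal one has the same origin `g`, so an edge contributes `1`,
`Δ`, or the prefix of a half boundary that leads to its real end. -/
theorem PrecellEdge.origin {e : FinPair M} {g : ArtinGroup M} {v w : Vertex M}
    (h : PrecellEdge e g v w) : v.origin⁻¹ * w.origin ∈ garsideAlphabet M := by
  cases h with
  | along t ht =>
    rw [e.origin_axis g ht]
    -- Only the last axis edge, `t = m - 2`, reaches the terminal vertex. For `m = 2` it is the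
    -- whole axis.
    rcases ht.eq_or_lt with h | h
    · rw [show t + 1 = e.m - 1 by omega, e.axis_terminal]
      simpa [Vertex.origin] using e.delta_mem_garsideAlphabet
    · rw [e.origin_axis g (by omega)]
      simpa using one_mem_garsideAlphabet
  | back b t h1 ht =>
    rw [e.origin_axis g ht]
    simpa [Vertex.origin] using e.half_mem_garsideAlphabet b h1 (by omega)
  | forth b t h1 ht =>
    rw [e.origin_axis g ht]
    simpa [Vertex.origin] using e.half_mem_garsideAlphabet b (t := t + 1) (by omega) (by omega)

/-- The common path starts at `h`, which therefore lies on a half boundary of the first precell at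
distance `t` from `g`; this is the case `s = 0` of the overlap. -/
theorem FinPair.Overlap.inv_mul_mem {e : FinPair M} {g h : ArtinGroup M} {t k : ℕ}
    (H : e.Overlap g h t k) : g⁻¹ * h ∈ garsideAlphabet M := by
  obtain ⟨h1, -, hm, b, b', hs⟩ := H
  have h0 := hs 0 (Nat.zero_le _)
  have hz : e.half b' 0 = 1 := by cases b' <;> simp [FinPair.half, altProd]
  rw [hz, add_zero, mul_one] at h0
  rw [← h0, inv_mul_cancel_left]
  exact e.half_mem_garsideAlphabet b h1 (by omega)

theorem ZigzagEdge.origin {e : FinPair M} {g h : ArtinGroup M} {v w : Vertex M}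
    (H : ZigzagEdge e g h v w) : v.origin⁻¹ * w.origin ∈ garsideAlphabet M := by
  cases H with
  | zig t k s ho hs =>
    have hm := ho.2.2.1
    have h1 := ho.1
    rw [e.origin_axis g (by omega), e.origin_axis h (by omega)]
    exact ho.inv_mul_mem
  | zag t k s ho hs =>
    have hm := ho.2.2.1
    have h1 := ho.1
    rw [e.origin_axis g (by omega), e.origin_axis h (by omega)]
    exact inv_mul_mem_garsideAlphabet_comm ho.inv_mul_mem

theorem PairEdge.origin {e : FinPair M} {v w : Vertex M} (h : PairEdge e v w) :
    v.origin⁻¹ * w.origin ∈ garsideAlphabet M := by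
  cases h with
  | cayley g k _ => simpa [Vertex.origin] using gen_mem_garsideAlphabet k
  | precell g v w h => exact h.origin
  | zigzag g h v w H => exact H.origin

/-- Any two vertices of a simplex of `X_ij` are based at elements that differ by a letter. -/
theorem FinPair.origin_of_mem_face {e : FinPair M} {s : Finset (Vertex M)}
    (hs : s ∈ e.complex.faces) {v w : Vertex M} (hv : v ∈ s) (hw : w ∈ s) :
    v.origin⁻¹ * w.origin ∈ garsideAlphabet M := by
  by_cases hvw : v = w
  · subst hvw
    simpa using one_mem_garsideAlphabet
  · have hadj := hs.2.2 (Finset.mem_coe.2 hv) (Finset.mem_coe.2 hw) hvw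
    rcases ((SimpleGraph.fromRel_adj _ _ _).1 hadj).2 with h | h
    · exact h.origin
    · exact inv_mul_mem_garsideAlphabet_comm h.origin

/-- Any two vertices of a simplex are based at elements that differ by a letter. -/
theorem IsSimplex.origin_of_mem {s : Finset (Vertex M)} (hs : IsSimplex M s)
    {v w : Vertex M} (hv : v ∈ s) (hw : w ∈ s) : v.origin⁻¹ * w.origin ∈ garsideAlphabet M := by
  cases hs with
  | vertex g =>
    rw [Finset.mem_singleton] at hv hw
    subst hv hw
    simpa using one_mem_garsideAlphabet
  | edge g k =>
    have h1 := one_mem_garsideAlphabet (M := M)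
    have hk := gen_mem_garsideAlphabet (M := M) k
    simp only [cayleyEdge, Finset.mem_insert, Finset.mem_singleton] at hv hw
    rcases hv with rfl | rfl <;> rcases hw with rfl | rfl
    · simpa using h1
    · simpa [Vertex.origin] using hk
    · simpa [Vertex.origin] using inv_mem_garsideAlphabet hk
    · simpa using h1
  | pair g e s hs =>
    obtain ⟨v, hv', rfl⟩ := Finset.mem_smul_finset.1 hv
    obtain ⟨w, hw', rfl⟩ := Finset.mem_smul_finset.1 hw
    simpa [Vertex.origin_smul, mul_assoc] using FinPair.origin_of_mem_face hs hv' hw'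

/-! ### Labels are origins: the upper bound -/

section Representatives

variable {V : Set (Finset (Vertex M))}

theorem IsOrbitReps.eq_of_smul_eq {S : Set (Finset (Vertex M))} (hV : IsOrbitReps ⊤ S V)
    {σ τ τ' : Finset (Vertex M)} (hσ : σ ∈ S) (hτ : τ ∈ V) (hτ' : τ' ∈ V)
    {g g' : ArtinGroup M} (h : σ = g • τ) (h' : σ = g' • τ') : τ = τ' :=
  (hV.2 σ hσ).unique ⟨hτ, g, trivial, h⟩ ⟨hτ', g', trivial, h'⟩

theorem IsBasedReps.cayleyEdge_mem (hV : IsBasedReps V) (k : Fin n) : cayleyEdge 1 k ∈ V := by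
  by_cases hk : IsIsolated M k
  · exact hV.isolated_mem k hk
  · obtain ⟨e, rfl | rfl⟩ := exists_finPair_of_not_isIsolated hk
    · exact (hV.pair_based e).edge_i_mem.1
    · exact (hV.pair_based e).edge_j_mem.1

theorem exists_origin_of_smul {σ τ : Finset (Vertex M)} {g : ArtinGroup M} (h : σ = g • τ)
    (hτ : ∃ v ∈ τ, v.origin = 1) : ∃ v ∈ σ, v.origin = g := by
  obtain ⟨v, hv, h1⟩ := hτ
  exact ⟨g • v, h ▸ Finset.smul_mem_smul_finset hv, by rw [v.origin_smul, h1, mul_one]⟩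

/-- A simplex has a vertex based at any of its labels. -/
theorem IsBasedReps.exists_origin (hV : IsBasedReps V) {σ : Finset (Vertex M)}
    (hσ : IsSimplex M σ) {g : ArtinGroup M} (hg : g ∈ labels V σ) : ∃ v ∈ σ, v.origin = g := by
  obtain ⟨τ, hτ, h⟩ := hg
  refine exists_origin_of_smul h ?_
  -- By uniqueness of orbit representatives, it suffices to exhibit for each kind of simplex some
  -- representative with a vertex of origin `1`.
  have key : ∀ τ' ∈ V, ∀ g', σ = g' • τ' → τ = τ' := fun τ' hτ' _ h' =>
    hV.reps.eq_of_smul_eq hσ hτ hτ' h h'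
  cases hσ with
  | vertex g' =>
    rw [key _ hV.base_mem g' (by simp [base, smul_real])]
    exact ⟨base M, Finset.mem_singleton_self _, rfl⟩
  | edge g' k =>
    rw [key _ (hV.cayleyEdge_mem k) g' (by rw [smul_cayleyEdge, mul_one])]
    exact ⟨.real 1, Finset.mem_insert_self _ _, rfl⟩
  | pair g' e s hs =>
    -- The representative under `G_ij` also lies in `V`, so it is the one under `G`, and it meets
    -- `v_0` or the interior of `Π_0`.
    obtain ⟨τ', ⟨hτ', x, -, hx⟩, -⟩ := (hV.pair_reps e).2 s hs
    rw [key τ' hτ'.1 (g' * x) (by rw [hx, mul_smul])]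
    rcases (hV.pair_based e).meets τ' hτ' with hb | ⟨t, ht⟩
    · exact ⟨_, hb, rfl⟩
    · exact ⟨_, ht, rfl⟩

theorem stabilizer_base_subset :
    (MulAction.stabilizer (ArtinGroup M) (base M) : Set (ArtinGroup M)) ⊆ garsideAlphabet M := by
  intro g hg
  have h : (Vertex.real (g * 1) : Vertex M) = .real 1 := hg
  injection h with h
  exact Or.inr (by simpa using h)

/-- Treats both alphabets at once: `ρ` is the union of the pair for `𝒜` and the larger simplex for
`ℬ`. -/
theorem IsBasedReps.pairLabels_subset (hV : IsBasedReps V) {σ τ ρ : Finset (Vertex M)}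
    (hσ : IsSimplex M σ) (hτ : IsSimplex M τ) (hρ : IsSimplex M ρ) (hσρ : σ ⊆ ρ) (hτρ : τ ⊆ ρ) :
    pairLabels V σ τ ⊆ garsideAlphabet M := by
  rintro _ ⟨x, hx, y, hy, rfl⟩
  obtain ⟨v, hv, hvx⟩ := hV.exists_origin hσ hx
  obtain ⟨w, hw, hwy⟩ := hV.exists_origin hτ hy
  have h := hρ.origin_of_mem (hσρ hv) (hτρ hw)
  rwa [hvx, hwy, inv_inv] at h

theorem IsBasedReps.alphabetA_subset (hV : IsBasedReps V) :
    alphabetA V ⊆ garsideAlphabet M := by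
  rintro g (hg | ⟨σ, hσ, τ, hτ, -, hu, hg⟩)
  · exact stabilizer_base_subset hg
  · exact hV.pairLabels_subset hσ hτ hu Finset.subset_union_left Finset.subset_union_right hg

theorem IsBasedReps.alphabetB_subset (hV : IsBasedReps V) :
    alphabetB V ⊆ garsideAlphabet M := by
  rintro g (hg | ⟨σ, hσ, τ, hτ, h | h, hg⟩)
  · exact stabilizer_base_subset hg
  · exact hV.pairLabels_subset hσ hτ hτ h subset_rfl hg
  · exact hV.pairLabels_subset hσ hτ hσ subset_rfl h hg

/-! ### Every generator occurs: the lower bound -/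

/-- A vertex is labelled by its origin. -/
theorem IsBasedReps.origin_mem_labels (hV : IsBasedReps V) (v : Vertex M) :
    v.origin ∈ labels V {v} := by
  cases v with
  | real g => exact ⟨_, hV.base_mem, by simp [base, smul_real, Vertex.origin]⟩
  | interior g e t =>
    exact ⟨_, ((hV.pair_based e).interior_vertex_mem t).1, by simp [smul_interior, Vertex.origin]⟩

/-- The edge lies in `V`, so it has label `1`, as has `v`, while `w` has its origin as a label.
Comparing `w` with `v` gives letters of `𝒜`, comparing it with the edge gives letters of `ℬ`; the
two orders give inverse letters. -/
theorem IsBasedReps.origin_mem_alphabets (hV : IsBasedReps V) {v w : Vertex M}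
    (hv : v.origin = 1) (hvw : {v, w} ∈ V) :
    (w.origin ∈ alphabetA V ∧ w.origin⁻¹ ∈ alphabetA V) ∧
      (w.origin ∈ alphabetB V ∧ w.origin⁻¹ ∈ alphabetB V) := by
  have hs : {v, w} ∈ (complex M).faces := hV.reps.1 hvw
  have h1 : 1 ∈ labels V {v} := hv ▸ hV.origin_mem_labels v
  have h2 := hV.origin_mem_labels w
  have h3 : 1 ∈ labels V {v, w} := ⟨_, hvw, (one_smul _ _).symm⟩
  have hsub : ({w} : Finset (Vertex M)) ⊆ {v, w} := by simp
  refine ⟨?_, Or.inr ⟨{v, w}, hs, {w}, .singleton w, .inr hsub, 1, by simpa using h3, _, h2, by simp⟩,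
    Or.inr ⟨{w}, .singleton w, {v, w}, hs, .inl hsub, _, Set.inv_mem_inv.2 h2, 1, h3, by simp⟩⟩
  -- If the edge degenerates, the letter is `1`, which the stabilizer supplies.
  by_cases h : v = w
  · subst h
    rw [hv, inv_one, and_self]
    exact Or.inl (one_mem _)
  · refine ⟨Or.inr ⟨{v}, .singleton v, {w}, .singleton w, by simpa using h, hs,
        1, by simpa using h1, _, h2, by simp⟩,
      Or.inr ⟨{w}, .singleton w, {v}, .singleton v, by simpa using Ne.symm h, ?_,
        _, Set.inv_mem_inv.2 h2, 1, h1, by simp⟩⟩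
    rw [Finset.union_comm]
    exact hs

/-- Every generator in `Y` is the origin of the end of an edge in `V` that starts at `v_0` or at an
interior vertex of some `Π_0`. -/
theorem IsBasedReps.exists_edge_mem (hV : IsBasedReps V) {g : ArtinGroup M}
    (hg : g ∈ garsideUnion M) :
    ∃ v w : Vertex M, v.origin = 1 ∧ w.origin = g ∧ {v, w} ∈ V := by
  have hgen : ∀ k, ∃ v w : Vertex M, v.origin = 1 ∧ w.origin = gen M k ∧ {v, w} ∈ V := fun k =>
    ⟨.real 1, .real (1 * gen M k), rfl, one_mul _, hV.cayleyEdge_mem k⟩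
  rcases hg with hg | ⟨k, -, rfl⟩
  · obtain ⟨e, b, t, h1, ht, rfl⟩ := Set.mem_iUnion.1 hg
    have hedge := fun v w h => ((hV.pair_based e).interior_edge_mem v w h).1
    have hm := e.two_le_m
    -- Length `1` comes from a Cayley edge at `v_0`, length `m` from the last axis edge, and a
    -- length `t` strictly between from the edge joining `o_{t-1}` to the half boundary at distance
    -- `t`.
    rcases h1.eq_or_lt with rfl | h1
    · cases b
      · rw [e.half_false_one]; exact hgen _
      · rw [e.half_true_one]; exact hgen _
    rcases ht.eq_or_lt with rfl | ht
    · obtain ⟨u, hu⟩ := Nat.exists_eq_add_of_le hm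
      refine ⟨_, _, e.origin_axis 1 (t := u) (by omega), ?_, hedge _ _ (.along u (by omega))⟩
      rw [show u + 1 = e.m - 1 by omega, e.axis_terminal, e.half_m]
      exact one_mul _
    · obtain ⟨u, rfl⟩ := Nat.exists_eq_add_of_le' h1.le
      exact ⟨_, _, e.origin_axis 1 (t := u) (by omega), one_mul _,
        hedge _ _ (.forth b u (by omega) (by omega))⟩
  · exact hgen k

theorem IsBasedReps.garsideAlphabet_subset (hV : IsBasedReps V) :
    garsideAlphabet M ⊆ alphabetA V ∩ alphabetB V := by
  rintro g ((hg | hg) | rfl)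
  · obtain ⟨v, w, hv, rfl, hvw⟩ := hV.exists_edge_mem hg
    have h := hV.origin_mem_alphabets hv hvw
    exact ⟨h.1.1, h.2.1⟩
  · obtain ⟨v, w, hv, hw, hvw⟩ := hV.exists_edge_mem hg
    have h := hV.origin_mem_alphabets hv hvw
    rw [hw, inv_inv] at h
    exact ⟨h.1.2, h.2.2⟩
  · exact ⟨Or.inl (one_mem _), Or.inl (one_mem _)⟩

end Representatives

end ArtinComplex

theorem mainTheorem1 {n : ℕ} (M : CoxeterMatrix (Fin n)) (hM : IsAlmostLarge M)
    (V : Set (Finset (ArtinComplex.Vertex M))) (hV : ArtinComplex.IsBasedReps V) :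
    ArtinComplex.alphabetA V =
        ArtinComplex.garsideUnion M ∪ (ArtinComplex.garsideUnion M)⁻¹ ∪ {1} ∧
      ArtinComplex.alphabetB V =
        ArtinComplex.garsideUnion M ∪ (ArtinComplex.garsideUnion M)⁻¹ ∪ {1} :=
  ⟨hV.alphabetA_subset.antisymm fun _ h => (hV.garsideAlphabet_subset h).1,
    hV.alphabetB_subset.antisymm fun _ h => (hV.garsideAlphabet_subset h).2⟩
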